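/- Let $\mathcal B_n$ be the Artin braid group on $n$ strands with standard generators $x_1,\dots,x_{n-1}$. Let $\nabla$ be the Alexander–Conway polynomial of oriented links, with values in $\mathbb C[s,s^{-1}]$, i.e. the unique invariant of oriented links with $\nabla(\text{unknot})=1$ and $\nabla(L_-)-(s^{-1}-s)\nabla(L_0)-\nabla(L_+)=0$ for every skein triple, with the convention that $L_-,L_0,L_+$ are the closures of braids $\alpha x_i\beta$, $\alpha\beta$, $\alpha x_i^{-1}\beta$. Write $\nabla_3(\beta)$ for the value of $\nabla$ on the closure of a $3$-braid $\beta$. For a nonzero Laurent polynomial $P=\sum_{j=q}^{p}c_js^j$ with $c_p\neq0\neq c_q$ put $\deg P=p$ and $\mathrm{br}\,P=p-q+1$ (and $\deg 0=-\infty$, $\mathrm{br}\,0=0$). Let $k\ge 1$ and let $a_1,\dots,a_{2k}$ be integers with $a_i\ge 2$ for all $i$. Then $$\deg\nabla_3\bigl(x_1^{a_1}x_2^{a_2}\cdots x_1^{a_{2k-1}}x_2^{a_{2k}}\bigr)=a_1+a_2+\cdots+a_{2k}-2,$$ and $$\mathrm{br}\,\nabla_3\bigl(x_1^{a_1}x_2^{a_2}\cdots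 x_1^{a_{2k-1}}x_2^{a_{2k}}\bigr)=2(a_1+a_2+\cdots+a_{2k})-3.$$ -/

import Mathlib

open LaurentPolynomial

noncomputable section

/-- Artin's relations on the generators `x_1, …, x_{n-1}` (here indexed by `0, …, n-2`). -/
def braidRelations (n : ℕ) : Set (FreeGroup (Fin (n - 1))) :=
  {r | ∃ i j : Fin (n - 1), (i : ℕ) + 1 = j ∧
      r = (FreeGroup.of i * FreeGroup.of j * FreeGroup.of i) *
        (FreeGroup.of j * FreeGroup.of i * FreeGroup.of j)⁻¹} ∪
  {r | ∃ i j : Fin (n - 1), (i : ℕ) + 1 < j ∧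
      r = (FreeGroup.of i * FreeGroup.of j) * (FreeGroup.of j * FreeGroup.of i)⁻¹}

/-- The Artin braid group on `n` strands. -/
abbrev BraidGroup (n : ℕ) : Type := PresentedGroup (braidRelations n)

namespace BraidGroup

/-- The Artin generators of the braid group on `n + 1` strands; `x i` is the generator usually
written `x_{i+1}`. -/
def x {n : ℕ} (i : Fin n) : BraidGroup (n + 1) :=
  PresentedGroup.of (rels := braidRelations (n + 1)) i

theorem x_braid {n : ℕ} (i j : Fin n) (h : (i : ℕ) + 1 = j) :
    x i * x j * x i = x j * x i * x j := by
  have := PresentedGroup.one_of_mem (rels := braidRelations (n + 1))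
    (Or.inl ⟨i, j, h, rfl⟩)
  rw [map_mul, map_inv, mul_inv_eq_one] at this
  exact this

theorem x_comm {n : ℕ} (i j : Fin n) (h : (i : ℕ) + 1 < j) : x i * x j = x j * x i := by
  have := PresentedGroup.one_of_mem (rels := braidRelations (n + 1))
    (Or.inr ⟨i, j, h, rfl⟩)
  rw [map_mul, map_inv, mul_inv_eq_one] at this
  exact this

/-- Homomorphisms out of the braid group. -/
def lift {n : ℕ} {G : Type*} [Group G] (f : Fin n → G)
    (h₁ : ∀ i j : Fin n, (i : ℕ) + 1 = j → f i * f j * f i = f j * f i * f j)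
    (h₂ : ∀ i j : Fin n, (i : ℕ) + 1 < j → f i * f j = f j * f i) :
    BraidGroup (n + 1) →* G :=
  PresentedGroup.toGroup (rels := braidRelations (n + 1)) (f := f) (by
    rintro r (⟨i, j, h, rfl⟩ | ⟨i, j, h, rfl⟩)
    · rw [map_mul, map_inv, mul_inv_eq_one]; simpa using h₁ i j h
    · rw [map_mul, map_inv, mul_inv_eq_one]; simpa using h₂ i j h)

theorem lift_x {n : ℕ} {G : Type*} [Group G] (f : Fin n → G)
    (h₁ : ∀ i j : Fin n, (i : ℕ) + 1 = j → f i * f j * f i = f j * f i * f j)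
    (h₂ : ∀ i j : Fin n, (i : ℕ) + 1 < j → f i * f j = f j * f i) (i : Fin n) :
    lift f h₁ h₂ (x i) = f i :=
  PresentedGroup.toGroup.of _

/-- The standard inclusion: add a trivial last strand. -/
def addStrand {n : ℕ} : BraidGroup (n + 1) →* BraidGroup (n + 2) :=
  lift (fun i => x i.castSucc) (fun _ _ h => x_braid _ _ h) (fun _ _ h => x_comm _ _ h)

theorem addStrand_x {n : ℕ} (i : Fin n) : addStrand (x i) = x i.castSucc :=
  lift_x _ _ _ i

theorem induction_left {n : ℕ} {P : BraidGroup (n + 1) → Prop} (one : P 1)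
    (mul : ∀ i β, P β → P (x i * β)) (inv_mul : ∀ i β, P β → P ((x i)⁻¹ * β))
    (β : BraidGroup (n + 1)) : P β := by
  have hβ : β ∈ Subgroup.closure (Set.range (x (n := n))) := by
    have := PresentedGroup.closure_range_of (braidRelations (n + 1))
    have h2 : Subgroup.closure (Set.range (x (n := n))) = ⊤ := this
    rw [h2]; trivial
  induction hβ using Subgroup.closure_induction_left with
  | one => exact one
  | mul_left a ha b _ ih => obtain ⟨i, rfl⟩ := ha; exact mul i b ih
  | inv_mul_cancel a ha b _ ih => obtain ⟨i, rfl⟩ := ha; exact inv_mul i b ih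

end BraidGroup

open BraidGroup

/-- The Markov moves on braids with an arbitrary positive number of strands: conjugation, and
positive or negative stabilization. -/
inductive MarkovMove : (Σ n : ℕ, BraidGroup (n + 1)) → (Σ n : ℕ, BraidGroup (n + 1)) → Prop
  | conj {n : ℕ} (α β : BraidGroup (n + 1)) : MarkovMove ⟨n, β⟩ ⟨n, α * β * α⁻¹⟩
  | stab {n : ℕ} (β : BraidGroup (n + 1)) :
      MarkovMove ⟨n, β⟩ ⟨n + 1, addStrand β * x (Fin.last n)⟩
  | stabInv {n : ℕ} (β : BraidGroup (n + 1)) :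
      MarkovMove ⟨n, β⟩ ⟨n + 1, addStrand β * (x (Fin.last n))⁻¹⟩

/-- Isotopy classes of (nonempty) oriented links in `ℝ³`. By the theorems of Alexander and Markov
these are the closed braids modulo the equivalence relation generated by the Markov moves. -/
def OrientedLink : Type := Quot MarkovMove

/-- The oriented link obtained by closing a braid. -/
def BraidGroup.closure {n : ℕ} (β : BraidGroup (n + 1)) : OrientedLink := Quot.mk _ ⟨n, β⟩

/-- The defining properties of the Alexander–Conway polynomial, in the variable `s = T 1`:
normalization on the unknot (the closure of the one-strand braid) and the skein relation
`∇(L₋) - (s⁻¹ - s) ∇(L₀) - ∇(L₊) = 0`, where `L₋`, `L₀`, `L₊` differ at one crossing only.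
Every skein triple is a triple of closures of braids `α x_i β`, `α β`, `α x_i⁻¹ β`. -/
structure IsAlexanderConway (P : OrientedLink → ℂ[T;T⁻¹]) : Prop where
  unknot : P (BraidGroup.closure (1 : BraidGroup 1)) = 1
  skein : ∀ {n : ℕ} (α β : BraidGroup (n + 1)) (i : Fin n),
    P (BraidGroup.closure (α * x i * β)) - (T (-1) - T 1) * P (BraidGroup.closure (α * β)) -
      P (BraidGroup.closure (α * (x i)⁻¹ * β)) = 0

/-! ### The skein relation determines the invariant -/

section Uniqueness

variable {K : Type*} [CommRing K] {z : K} {I : AddSubgroup K}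

theorem addStrand_comm_last {n : ℕ} (β : BraidGroup (n + 1)) :
    x (Fin.last (n + 1)) * addStrand (addStrand β) =
      addStrand (addStrand β) * x (Fin.last (n + 1)) := by
  have key : ∀ i : Fin n, Commute (x (Fin.last (n + 1))) (x i.castSucc.castSucc) := by
    intro i
    exact (x_comm _ _ (by simp)).symm
  change Commute _ _
  induction β using induction_left with
  | one => simp
  | mul i β ih => rw [map_mul, map_mul, addStrand_x, addStrand_x]; exact (key i).mul_right ih
  | inv_mul i β ih =>
    rw [map_mul, map_mul, map_inv, map_inv, addStrand_x, addStrand_x]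
    exact (key i).inv_right.mul_right ih

/-- A function on braids satisfying the skein relation with parameter `z`. -/
def SkeinFun (z : K) {n : ℕ} (g : BraidGroup (n + 1) → K) : Prop :=
  ∀ α β i, g (α * x i * β) - z * g (α * β) - g (α * (x i)⁻¹ * β) = 0

theorem SkeinFun.mulLeft {n : ℕ} {g : BraidGroup (n + 1) → K} (hg : SkeinFun z g)
    (c d : BraidGroup (n + 1)) : SkeinFun z (fun γ => g (c * γ * d)) := by
  intro α β j
  simpa only [mul_assoc] using hg (c * α) (β * d) j

theorem SkeinFun.addStrand {n : ℕ} {g : BraidGroup (n + 2) → K} (hg : SkeinFun z g) :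
    SkeinFun z (fun γ => g (addStrand γ)) := by
  intro α β j
  simpa only [map_mul, map_inv, addStrand_x] using
    hg (BraidGroup.addStrand α) (BraidGroup.addStrand β) j.castSucc

/-- `g` takes values in `I` on the braids with at most one occurrence of the last generator. -/
def SmallIn (I : AddSubgroup K) {n : ℕ} (g : BraidGroup (n + 2) → K) : Prop :=
  (∀ a, g (addStrand a) ∈ I) ∧ ∀ a b, g (addStrand a * x (Fin.last n) * addStrand b) ∈ I

theorem skein_step (hI : ∀ a ∈ I, z * a ∈ I) {n : ℕ}
    (H : ∀ g : BraidGroup (n + 2) → K, SkeinFun z g → SmallIn I g →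
      ∀ a b, g (x (Fin.last n) * addStrand a * x (Fin.last n) * addStrand b) ∈ I)
    (g : BraidGroup (n + 2) → K) (hg : SkeinFun z g) (h : SmallIn I g) (β) : g β ∈ I := by
  have shift : ∀ (g : BraidGroup (n + 2) → K), SkeinFun z g → SmallIn I g → ∀ i,
      SkeinFun z (fun γ => g (x i * γ)) ∧ SmallIn I (fun γ => g (x i * γ)) := by
    intro g hg h i
    refine ⟨by simpa using hg.mulLeft (x i) 1, fun a => ?_, fun a b => ?_⟩
    · induction i using Fin.lastCases with
      | last => simpa using h.2 1 a
      | cast i => simpa only [map_mul, addStrand_x] using h.1 (x i * a)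
    · induction i using Fin.lastCases with
      | last => simpa only [mul_assoc] using H g hg h a b
      | cast i => simpa only [map_mul, addStrand_x, mul_assoc] using h.2 (x i * a) b
  induction β using induction_left generalizing g with
  | one => simpa using h.1 1
  | mul i β ih => exact ih _ (shift g hg h i).1 (shift g hg h i).2
  | inv_mul i β ih =>
    have e : g ((x i)⁻¹ * β) = g (x i * β) - z * g β := by
      have := hg 1 β i
      simp only [one_mul] at this
      linear_combination -this
    rw [e]
    exact I.sub_mem (ih _ (shift g hg h i).1 (shift g hg h i).2) (hI _ (ih g hg h))

theorem skein_sq (hI : ∀ a ∈ I, z * a ∈ I) {n : ℕ} {g : BraidGroup (n + 2) → K}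
    (hg : SkeinFun z g) (h : SmallIn I g) (a b) :
    g (addStrand a * (x (Fin.last n) * (x (Fin.last n) * addStrand b))) ∈ I := by
  have := hg (addStrand a) (x (Fin.last n) * addStrand b) (Fin.last n)
  rw [mul_assoc (addStrand a) (x (Fin.last n))⁻¹, inv_mul_cancel_left, ← map_mul,
    ← mul_assoc, ← mul_assoc] at this
  rw [show g (addStrand a * (x (Fin.last n) * (x (Fin.last n) * addStrand b))) =
    z * g (addStrand a * x (Fin.last n) * addStrand b) + g (addStrand (a * b)) by
      simp only [mul_assoc] at this ⊢
      linear_combination this]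
  exact I.add_mem (hI _ (h.2 _ _)) (h.1 _)

theorem skein_span (hI : ∀ a ∈ I, z * a ∈ I) : ∀ (n : ℕ) (g : BraidGroup (n + 2) → K),
    SkeinFun z g → SmallIn I g → ∀ β, g β ∈ I := by
  intro n
  induction n with
  | zero =>
    apply skein_step hI
    intro g hg h a b
    have ha : a = 1 := by
      induction a using induction_left with
      | one => rfl
      | mul i => exact i.elim0
      | inv_mul i => exact i.elim0
    subst ha
    simpa [mul_assoc] using skein_sq hI hg h 1 b
  | succ n ih =>
    apply skein_step hI
    intro g hg h a b
    refine ih (fun a => g (x (Fin.last (n + 1)) * addStrand a * x (Fin.last (n + 1)) *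
      addStrand b)) ?_ ⟨fun c => ?_, fun c d => ?_⟩ a
    · simpa only [mul_assoc] using
        (hg.mulLeft (x (Fin.last (n + 1))) (x (Fin.last (n + 1)) * addStrand b)).addStrand
    · beta_reduce
      rw [addStrand_comm_last]
      simpa only [mul_assoc] using skein_sq hI hg h (addStrand c) b
    · have br := x_braid (Fin.last n).castSucc (Fin.last (n + 1)) (by simp)
      have e : x (Fin.last (n + 1)) *
          addStrand (addStrand c * x (Fin.last n) * addStrand d) * x (Fin.last (n + 1)) *
          addStrand b = addStrand (addStrand c * x (Fin.last n)) * x (Fin.last (n + 1)) *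
          addStrand (x (Fin.last n) * addStrand d * b) := by
        simp only [map_mul, addStrand_x]
        calc _ = (x (Fin.last (n + 1)) * addStrand (addStrand c)) * x (Fin.last n).castSucc *
              (addStrand (addStrand d) * x (Fin.last (n + 1))) * addStrand b := by
                simp only [mul_assoc]
          _ = addStrand (addStrand c) * (x (Fin.last (n + 1)) * x (Fin.last n).castSucc *
              x (Fin.last (n + 1))) * addStrand (addStrand d) * addStrand b := by
                rw [addStrand_comm_last c, ← addStrand_comm_last d]
                simp only [mul_assoc]
          _ = _ := by rw [← br]; simp only [mul_assoc]
      change g (_ * _ * _ * _) ∈ I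
      rw [e]
      exact h.2 _ _

/-- A conjugation and stabilization invariant function on braids. -/
structure MarkovSkein (z : K) (f : ∀ n : ℕ, BraidGroup (n + 1) → K) : Prop where
  comm : ∀ {n} (α β : BraidGroup (n + 1)), f n (α * β) = f n (β * α)
  stab : ∀ {n} (β : BraidGroup (n + 1)), f (n + 1) (addStrand β * x (Fin.last n)) = f n β
  stabInv : ∀ {n} (β : BraidGroup (n + 1)),
    f (n + 1) (addStrand β * (x (Fin.last n))⁻¹) = f n β
  skein : ∀ n, SkeinFun z (f n)

theorem MarkovSkein.mem [IsDomain K] (hz : z ≠ 0) (hI : ∀ a ∈ I, z * a ∈ I)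
    {f : ∀ n : ℕ, BraidGroup (n + 1) → K} (hf : MarkovSkein z f) (h1 : f 0 1 ∈ I) (n : ℕ)
    (β : BraidGroup (n + 1)) : f n β ∈ I := by
  induction n with
  | zero =>
    induction β using induction_left with
    | one => exact h1
    | mul i => exact i.elim0
    | inv_mul i => exact i.elim0
  | succ n ih =>
    refine skein_span hI n (f (n + 1)) (hf.skein _) ⟨fun a => ?_, fun a b => ?_⟩ β
    · have := hf.skein (n + 1) (addStrand a) 1 (Fin.last n)
      simp only [mul_one, hf.stab, hf.stabInv] at this
      have h0 : z * f (n + 1) (addStrand a) = 0 := by linear_combination -this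
      rw [(mul_eq_zero.1 h0).resolve_left hz]
      exact I.zero_mem
    · rw [hf.comm, ← mul_assoc, ← map_mul, hf.stab]
      exact ih _

end Uniqueness

/-! ### Existence of the invariant -/

section Existence

open Matrix

variable {K : Type*} [Field K] (t : K)

def burauRow {m : ℕ} (i k : Fin m) : K :=
  if k = i then -(1 + t) else if (k : ℕ) = i + 1 then 1 else if (k : ℕ) + 1 = i then t else 0

def burauE {m : ℕ} (i : Fin m) : Matrix (Fin m) (Fin m) K :=
  vecMulVec (Pi.single i 1) (burauRow t i)

theorem burauE_mul {m : ℕ} (i j : Fin m) :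
    burauE t i * burauE t j = burauRow t i j • vecMulVec (Pi.single i 1) (burauRow t j) := by
  simp [burauE, vecMulVec_mul_vecMulVec, vecMulVec_smul]

theorem burauE_sq {m : ℕ} (i : Fin m) : burauE t i * burauE t i = -(1 + t) • burauE t i := by
  rw [burauE_mul]; simp [burauRow, burauE]

theorem burauE_far {m : ℕ} (i j : Fin m) (h : (i : ℕ) + 1 < j) :
    burauE t i * burauE t j = 0 ∧ burauE t j * burauE t i = 0 := by
  have h1 : burauRow t i j = 0 := by
    unfold burauRow; rw [if_neg (by omega), if_neg (by omega), if_neg (by omega)]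
  have h2 : burauRow t j i = 0 := by
    unfold burauRow; rw [if_neg (by omega), if_neg (by omega), if_neg (by omega)]
  simp [burauE_mul, h1, h2]

theorem burauE_near {m : ℕ} (i j : Fin m) (h : (i : ℕ) + 1 = j) :
    burauE t i * burauE t j * burauE t i = t • burauE t i ∧
      burauE t j * burauE t i * burauE t j = t • burauE t j := by
  have h1 : burauRow t i j = 1 := by
    unfold burauRow; rw [if_neg (by omega), if_pos (by omega)]
  have h2 : burauRow t j i = t := by
    unfold burauRow; rw [if_neg (by omega), if_neg (by omega), if_pos (by omega)]
  simp [h1, h2, burauE, vecMulVec_mul_vecMulVec, vecMulVec_smul]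

variable {t} in
/-- The reduced Burau matrix of an Artin generator. -/
def burauGen (ht : t ≠ 0) {m : ℕ} (i : Fin m) : (Matrix (Fin m) (Fin m) K)ˣ where
  val := 1 + burauE t i
  inv := 1 + t⁻¹ • burauE t i
  val_inv := by
    have := burauE_sq t i
    simp only [add_mul, mul_add, one_mul, mul_one, mul_smul_comm, this]
    match_scalars <;> field_simp
    ring
  inv_val := by
    have := burauE_sq t i
    simp only [add_mul, mul_add, one_mul, mul_one, smul_mul_assoc, this]
    match_scalars <;> field_simp
    ring

variable {t} in
/-- The reduced Burau representation. -/
def burau (ht : t ≠ 0) (m : ℕ) : BraidGroup (m + 1) →* (Matrix (Fin m) (Fin m) K)ˣ :=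
  BraidGroup.lift (burauGen ht)
    (by
      intro i j h
      ext1
      obtain ⟨h1, h2⟩ := burauE_near t i j h
      simp only [Units.val_mul, burauGen, add_mul, mul_add, one_mul, mul_one, burauE_sq, h1, h2]
      module)
    (by
      intro i j h
      ext1
      obtain ⟨h1, h2⟩ := burauE_far t i j h
      simp only [Units.val_mul, burauGen, add_mul, mul_add, one_mul, mul_one, h1, h2]
      module)

variable {t} in
theorem burau_x (ht : t ≠ 0) {m : ℕ} (i : Fin m) : burau ht m (x i) = burauGen ht i :=
  lift_x _ _ _ i

/-- The quantum integer `1 + t + ⋯ + t^(n-1)`. -/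
def qint (n : ℕ) : K := ∑ i ∈ Finset.range n, t ^ i

variable {t} (ht : t ≠ 0)

/-- The vector `w` fixed by the image of `addStrand`. -/
def fixVec (t : K) (m : ℕ) (j : Fin (m + 1)) : K := qint t (j + 1) / qint t (m + 1)

theorem burauRow_fixVec (hq : ∀ n, qint t (n + 1) ≠ 0) {m : ℕ} (i : Fin (m + 1)) :
    burauRow t i ⬝ᵥ fixVec t m =
      if i = Fin.last m then - qint t (m + 2) / qint t (m + 1) else 0 := by
  have h0 := hq m
  have hrec : ∀ n, qint t (n + 2) = (1 + t) * qint t (n + 1) - t * qint t n := by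
    intro n
    induction n with
    | zero => simp [qint, Finset.sum_range_succ]
    | succ n ih =>
      have e1 : qint t (n + 1 + 2) = qint t (n + 2) + t ^ (n + 2) := Finset.sum_range_succ _ _
      have e2 : qint t (n + 2) = qint t (n + 1) + t ^ (n + 1) := Finset.sum_range_succ _ _
      have e3 : qint t (n + 1) = qint t n + t ^ n := Finset.sum_range_succ _ _
      rw [e1, e2, e3]
      rw [e2, e3] at ih
      linear_combination ih
  have hsum : burauRow t i ⬝ᵥ fixVec t m = ∑ k ∈ Finset.range (m + 1),
      ((if k = (i : ℕ) then -(1 + t) * (qint t (k + 1) / qint t (m + 1)) else 0) +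
        (if k = (i : ℕ) + 1 then qint t (k + 1) / qint t (m + 1) else 0) +
        (if (i : ℕ) = k + 1 then t * (qint t (k + 1) / qint t (m + 1)) else 0)) := by
    rw [dotProduct, ← Fin.sum_univ_eq_sum_range (fun k =>
      ((if k = (i : ℕ) then -(1 + t) * (qint t (k + 1) / qint t (m + 1)) else 0) +
        (if k = (i : ℕ) + 1 then qint t (k + 1) / qint t (m + 1) else 0) +
        (if (i : ℕ) = k + 1 then t * (qint t (k + 1) / qint t (m + 1)) else 0)))]
    refine Finset.sum_congr rfl fun k _ => ?_
    unfold burauRow fixVec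
    simp only [Fin.ext_iff]
    split_ifs <;> first | omega | ring
  have h3 : ∑ k ∈ Finset.range (m + 1),
      (if (i : ℕ) = k + 1 then t * (qint t (k + 1) / qint t (m + 1)) else 0) =
      t * (qint t i / qint t (m + 1)) := by
    obtain ⟨i, hi⟩ := i
    cases i with
    | zero => simp [qint]
    | succ j => simp; omega
  rw [hsum, Finset.sum_add_distrib, Finset.sum_add_distrib, h3, Finset.sum_ite_eq',
    Finset.sum_ite_eq', if_pos (by simp; omega)]
  by_cases hi : i = Fin.last m
  · subst hi
    simp only [Fin.val_last, Finset.mem_range, lt_irrefl, if_false, if_true]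
    rw [hrec m]
    field_simp
    ring
  · have : (i : ℕ) ≠ m := fun h => hi (Fin.ext h)
    rw [if_neg hi, if_pos (by simp; omega), hrec i]
    field_simp
    ring

/-- `X` is block triangular with upper left block `Y`, and fixes `fixVec`. -/
def BlockExt (t : K) {m : ℕ} (X : Matrix (Fin (m + 1)) (Fin (m + 1)) K)
    (Y : Matrix (Fin m) (Fin m) K) : Prop :=
  (∀ a b, X (Fin.castSucc a) (Fin.castSucc b) = Y a b) ∧
  (∀ k, X (Fin.last m) k = if k = Fin.last m then 1 else 0) ∧ X *ᵥ fixVec t m = fixVec t m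

theorem BlockExt.mul {m : ℕ} {X X' : Matrix (Fin (m + 1)) (Fin (m + 1)) K}
    {Y Y' : Matrix (Fin m) (Fin m) K} (h : BlockExt t X Y) (h' : BlockExt t X' Y') :
    BlockExt t (X * X') (Y * Y') := by
  refine ⟨fun a b => ?_, fun k => ?_, ?_⟩
  · rw [mul_apply, mul_apply, Fin.sum_univ_castSucc, h'.2.1, if_neg (Fin.castSucc_ne_last b)]
    simp [h.1, h'.1]
  · rw [mul_apply]
    simp [h.2.1, h'.2.1]
  · rw [← mulVec_mulVec, h'.2.2, h.2.2]

theorem BlockExt.gen (hq : ∀ n, qint t (n + 1) ≠ 0) {m : ℕ} (i : Fin m) (c : K) :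
    BlockExt t (1 + c • burauE t i.castSucc) (1 + c • burauE t i) := by
  refine ⟨fun a b => ?_, fun k => ?_, ?_⟩
  · simp [burauE, vecMulVec_apply, burauRow, one_apply, Pi.single_apply]
  · have : (Fin.last m) ≠ i.castSucc := (Fin.castSucc_ne_last i).symm
    simp [burauE, vecMulVec_apply, one_apply, this, eq_comm]
  · rw [add_mulVec, one_mulVec, smul_mulVec, burauE, vecMulVec_mulVec, burauRow_fixVec hq,
      if_neg (Fin.castSucc_ne_last i)]
    simp

theorem burau_addStrand (hq : ∀ n, qint t (n + 1) ≠ 0) {m : ℕ} (β : BraidGroup (m + 1)) :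
    BlockExt t (burau ht (m + 1) (addStrand β)).val (burau ht m β).val := by
  induction β using induction_left with
  | one =>
    simpa using BlockExt.mul (t := t) (X := 1) (Y := 1) (X' := 1) (Y' := 1) 
      ⟨by simp [one_apply], by simp [one_apply, eq_comm], by simp⟩
      ⟨by simp [one_apply], by simp [one_apply, eq_comm], by simp⟩
  | mul i β ih =>
    have := (BlockExt.gen hq i 1).mul ih
    rw [one_smul, one_smul] at this
    rw [map_mul, map_mul, map_mul, addStrand_x, burau_x, burau_x]
    exact this
  | inv_mul i β ih =>
    have := (BlockExt.gen hq i t⁻¹).mul ih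
    rw [map_mul, map_mul, map_mul, map_inv, map_inv, map_inv, addStrand_x, burau_x, burau_x]
    exact this

theorem det_row (m : ℕ) (N : Matrix (Fin m) (Fin m) K) (i : Fin m) (c : K) :
    (N + c • burauE t i).det = N.det + c * (N.updateRow i (burauRow t i)).det := by
  have : N + c • burauE t i = N.updateRow i (N i + c • burauRow t i) := by
    ext a b
    by_cases h : a = i
    · subst h; simp [burauE, vecMulVec_apply]
    · simp [burauE, vecMulVec_apply, h]
  rw [this, det_updateRow_add, det_updateRow_smul, updateRow_eq_self]

theorem det_skein {s : K} (hs : s ≠ 0) (hst : t = s ^ 2) {m : ℕ} (A : (Matrix (Fin m) (Fin m) K)ˣ)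
    (i : Fin m) :
    s⁻¹ * (1 - A.val * (burauGen ht i).val).det - (s⁻¹ - s) * (1 - A.val).det
      - s * (1 - A.val * (burauGen ht i)⁻¹.val).det = 0 := by
  have key : ∀ c : K, (1 - A.val * (1 + c • burauE t i)).det =
      (1 - A.val).det - c * (A.val.det * ((A⁻¹.val - 1).updateRow i (burauRow t i)).det) := by
    intro c
    have e : 1 - A.val * (1 + c • burauE t i) =
        A.val * ((A⁻¹.val - 1) + (-c) • burauE t i) := by
      rw [mul_add, mul_add, mul_sub, Units.mul_inv]
      simp only [mul_one, neg_smul, mul_neg]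
      abel
    have e2 : (1 - A.val) = A.val * (A⁻¹.val - 1) := by
      rw [mul_sub, Units.mul_inv, mul_one]
    rw [e, det_mul, det_row, e2, det_mul]
    ring
  have k1 := key 1
  have k2 := key t⁻¹
  rw [one_smul] at k1
  change s⁻¹ * (1 - A.val * (1 + burauE t i)).det - _ - s * (1 - A.val * (1 + t⁻¹ • burauE t i)).det = 0
  rw [k1, k2, hst]
  field_simp
  ring

theorem det_last_col {m : ℕ} (M : Matrix (Fin (m + 1)) (Fin (m + 1)) K) (c : K)
    (w : Fin (m + 1) → K) (hw : w (Fin.last m) = 1) (h : M *ᵥ w = Pi.single (Fin.last m) c) :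
    M.det = c * (M.submatrix Fin.castSucc Fin.castSucc).det := by
  have h1 : cramer M (M *ᵥ w) = M.det • w := by
    rw [cramer_eq_adjugate_mulVec, mulVec_mulVec, adjugate_mul, smul_mulVec, one_mulVec]
  have h2 := congrFun h1 (Fin.last m)
  rw [Pi.smul_apply, hw, smul_eq_mul, mul_one, h, cramer_apply] at h2
  rw [← h2, det_succ_column _ (Fin.last m), Finset.sum_eq_single (Fin.last m)]
  · simp only [Fin.val_last, updateCol_self, Pi.single_eq_same, Fin.succAbove_last]
    rw [Even.neg_one_pow ⟨m, rfl⟩, one_mul]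
    congr 2
    ext a b
    simp [Fin.castSucc_ne_last]
  · intro b _ hb
    simp [hb]
  · simp

theorem det_stab (hq : ∀ n, qint t (n + 1) ≠ 0) {m : ℕ} (β : BraidGroup (m + 1)) :
    (1 - (burau ht (m + 1) (addStrand β)).val).det = 0 ∧
    (1 - (burau ht (m + 1) (addStrand β)).val * (burauGen ht (Fin.last m)).val).det =
      qint t (m + 2) / qint t (m + 1) * (1 - (burau ht m β).val).det := by
  obtain ⟨h1, h2, h3⟩ := burau_addStrand ht hq β
  set X := (burau ht (m + 1) (addStrand β)).val
  set Y := (burau ht m β).val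
  have hz : (1 - X).det = 0 := by
    apply det_eq_zero_of_row_eq_zero (Fin.last m)
    intro k
    simp [h2, one_apply, eq_comm]
  refine ⟨hz, ?_⟩
  have hE : X * burauE t (Fin.last m) = burauE t (Fin.last m) -
      (1 - X) * burauE t (Fin.last m) := by
    rw [sub_mul, one_mul, sub_sub_cancel]
  have e : 1 - X * (burauGen ht (Fin.last m)).val =
      ((1 - X) + t⁻¹ • burauE t (Fin.last m)) * (1 + burauE t (Fin.last m)) := by
    change 1 - X * (1 + burauE t (Fin.last m)) = _
    simp only [mul_add, add_mul, mul_one, smul_mul_assoc, burauE_sq, hE]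
    match_scalars <;> field_simp
    ring
  have hS : (1 + burauE t (Fin.last m)).det = -t := by
    have := det_one_add_replicateCol_mul_replicateRow (ι := Unit)
      (Pi.single (Fin.last m) (1 : K)) (burauRow t (Fin.last m))
    rw [← vecMulVec_eq] at this
    rw [burauE, this]
    simp [burauRow]
  have hrow := det_last_col ((1 - X).updateRow (Fin.last m) (burauRow t (Fin.last m)))
    (- qint t (m + 2) / qint t (m + 1)) (fixVec t m)
    (by simp [fixVec, div_self (hq m)]) (by
      ext a
      by_cases ha : a = Fin.last m
      · subst ha
        have := burauRow_fixVec hq (Fin.last m)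
        rw [if_pos rfl] at this
        simpa [mulVec] using this
      · have h4 : ((1 - X) *ᵥ fixVec t m) a = 0 := by
          rw [sub_mulVec, one_mulVec, h3, sub_self, Pi.zero_apply]
        simpa [mulVec, ha] using h4)
  have hsub : ((1 - X).updateRow (Fin.last m) (burauRow t (Fin.last m))).submatrix
      Fin.castSucc Fin.castSucc = 1 - Y := by
    ext a b
    simp [updateRow_apply, Fin.castSucc_ne_last, h1, one_apply]
  rw [hsub] at hrow
  rw [e, det_mul, hS, det_row, hz, hrow]
  field_simp
  ring

/-- The homomorphism sending every Artin generator to `u`. -/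
def expHom {G : Type*} [CommGroup G] (u : G) (m : ℕ) : BraidGroup (m + 1) →* G :=
  BraidGroup.lift (fun _ => u) (fun _ _ _ => rfl) (fun _ _ _ => rfl)

theorem expHom_x {G : Type*} [CommGroup G] (u : G) {m : ℕ} (i : Fin m) : expHom u m (x i) = u :=
  lift_x _ _ _ i

theorem expHom_addStrand {G : Type*} [CommGroup G] (u : G) {m : ℕ} (β : BraidGroup (m + 1)) :
    expHom u (m + 1) (addStrand β) = expHom u m β := by
  have : (expHom u (m + 1)).comp addStrand = expHom u m := by
    apply PresentedGroup.ext
    intro i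
    exact (congrArg (expHom u (m + 1)) (addStrand_x i)).trans
      ((expHom_x u _).trans (expHom_x u i).symm)
  exact DFunLike.congr_fun this β

/-- The normalized Burau determinant. -/
def burauInv (s : Kˣ) (n : ℕ) (β : BraidGroup (n + 1)) : K :=
  (s : K) ^ n * ((expHom s⁻¹ n β : Kˣ) : K) * (1 - (burau ht n β).val).det / qint t (n + 1)

theorem markovSkein_burau (s : Kˣ) (hst : t = (s : K) ^ 2) (hq : ∀ n, qint t (n + 1) ≠ 0) :
    MarkovSkein ((s : K)⁻¹ - s) (burauInv ht s) := by
  have hs : (s : K) ≠ 0 := s.ne_zero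
  have comm : ∀ {n} (α β : BraidGroup (n + 1)),
      burauInv ht s n (α * β) = burauInv ht s n (β * α) := by
    intro n α β
    unfold burauInv
    rw [map_mul, map_mul, map_mul, map_mul, Units.val_mul (burau ht n α), Units.val_mul (burau ht n β),
      det_one_sub_mul_comm, mul_comm (expHom _ _ α)]
  have sk : ∀ {n} (α : BraidGroup (n + 1)) (i : Fin n),
      burauInv ht s n (α * x i) - ((s : K)⁻¹ - s) * burauInv ht s n α -
        burauInv ht s n (α * (x i)⁻¹) = 0 := by
    intro n α i
    have := det_skein ht hs hst (burau ht n α) i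
    have hx : burau ht n (x i) = burauGen ht i := lift_x _ _ _ i
    unfold burauInv
    rw [map_mul, map_mul, map_mul, map_mul, map_inv, map_inv, expHom_x, hx, inv_inv,
      Units.val_mul (burau ht n α), Units.val_mul (burau ht n α), Units.val_mul (expHom _ _ α),
      Units.val_mul (expHom _ _ α), Units.val_inv_eq_inv_val s]
    linear_combination ((s : K) ^ n * ((expHom s⁻¹ n α : Kˣ) : K) / qint t (n + 1)) * this
  have stab : ∀ {n} (β : BraidGroup (n + 1)),
      burauInv ht s (n + 1) (addStrand β) = 0 ∧
      burauInv ht s (n + 1) (addStrand β * x (Fin.last n)) = burauInv ht s n β := by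
    intro n β
    have hx : burau ht (n + 1) (x (Fin.last n)) = burauGen ht (Fin.last n) := lift_x _ _ _ _
    obtain ⟨h0, h1⟩ := det_stab ht hq β
    have q1 := hq n
    have q2 : qint t (n + 2) ≠ 0 := hq (n + 1)
    unfold burauInv
    constructor
    · rw [h0]; simp
    · rw [map_mul, map_mul, hx, Units.val_mul (burau ht _ _), h1, expHom_x, expHom_addStrand,
        Units.val_mul (expHom _ _ β), Units.val_inv_eq_inv_val s]
      field_simp
      ring
  refine ⟨comm, fun β => (stab β).2, fun {n} β => ?_, fun n α β i => ?_⟩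
  · have := sk (addStrand β) (Fin.last n)
    rw [(stab β).1, (stab β).2] at this
    linear_combination -this
  · have := sk (β * α) i
    rw [comm (α * x i) β, comm α β, comm (α * (x i)⁻¹) β, ← mul_assoc, ← mul_assoc]
    exact this

end Existence

/-- The Alexander–Conway polynomial exists and is unique. -/
theorem existsUnique_alexanderConway : ∃! P : OrientedLink → ℂ[T;T⁻¹], IsAlexanderConway P := by
  set R := ℂ[T;T⁻¹]
  set K := FractionRing R
  set z : R := T (-1) - T 1 with hzdef
  have hz : z ≠ 0 := by
    intro h
    have h1 := congrArg (eval₂ (RingHom.id ℂ) (Units.mk0 2 two_ne_zero)) h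
    rw [hzdef, map_sub, eval₂_T, eval₂_T, map_zero] at h1
    norm_num at h1
  have inj : Function.Injective (algebraMap R K) := IsFractionRing.injective R K
  -- the pullback of a link invariant to braids
  have pull : ∀ P : OrientedLink → R, IsAlexanderConway P →
      MarkovSkein z (fun _ β => P (closure β)) := by
    intro P hP
    refine ⟨fun α β => congrArg P ?_, fun β => congrArg P (Quot.sound (.stab β)).symm,
      fun β => congrArg P (Quot.sound (.stabInv β)).symm, fun n α β i => hP.skein α β i⟩
    have := Quot.sound (MarkovMove.conj α (β * α))
    rw [← mul_assoc α, mul_inv_cancel_right] at this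
    exact this.symm
  have uniq : ∀ P Q, IsAlexanderConway P → IsAlexanderConway Q → P = Q := by
    intro P Q hP hQ
    have h1 := pull P hP
    have h2 := pull Q hQ
    have hd : MarkovSkein z (fun n (β : BraidGroup (n + 1)) => P (closure β) - Q (closure β)) := by
      refine ⟨fun α β => ?_, fun β => ?_, fun β => ?_, fun n α β i => ?_⟩
      · exact congrArg₂ (· - ·) (h1.comm α β) (h2.comm α β)
      · exact congrArg₂ (· - ·) (h1.stab β) (h2.stab β)
      · exact congrArg₂ (· - ·) (h1.stabInv β) (h2.stabInv β)
      · have e1 := h1.skein n α β i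
        have e2 := h2.skein n α β i
        linear_combination e1 - e2
    funext L
    obtain ⟨⟨n, β⟩, rfl⟩ := Quot.exists_rep L
    have := hd.mem (I := ⊥) hz (by simp) (by simp [hP.unknot, hQ.unknot]) n β
    exact sub_eq_zero.1 (AddSubgroup.mem_bot.1 this)
  -- existence
  let s : Kˣ := ⟨algebraMap R K (T 1), algebraMap R K (T (-1)),
    by rw [← map_mul, ← T_add]; simp, by rw [← map_mul, ← T_add]; simp⟩
  have hq : ∀ n, qint ((s : K) ^ 2) (n + 1) ≠ 0 := by
    intro n h
    have h1 : qint ((s : K) ^ 2) (n + 1) =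
        algebraMap R K (∑ i ∈ Finset.range (n + 1), ((T 1 : R) ^ 2) ^ i) := by
      simp only [qint, s, map_sum, map_pow]
    rw [h1, map_eq_zero_iff _ inj] at h
    have h2 := congrArg (eval₂ (RingHom.id ℂ) (1 : ℂˣ)) h
    simp only [map_sum, map_pow, eval₂_T, map_zero] at h2
    simp at h2
    exact Nat.cast_add_one_ne_zero n h2
  have hsz : (s : K)⁻¹ - s = algebraMap R K z := by
    rw [hzdef, map_sub, ← Units.val_inv_eq_inv_val]
    rfl
  have hM := markovSkein_burau (pow_ne_zero 2 s.ne_zero) s rfl hq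
  rw [hsz] at hM
  set F := burauInv (pow_ne_zero 2 s.ne_zero) s
  have hF1 : F 0 1 = 1 := by simp [F, burauInv, qint]
  have hmem : ∀ n β, F n β ∈ (algebraMap R K).range.toAddSubgroup := by
    intro n β
    refine hM.mem ((map_ne_zero_iff _ inj).2 hz) ?_ ?_ n β
    · rintro _ ⟨a, rfl⟩
      exact ⟨z * a, map_mul _ _ _⟩
    · rw [hF1]; exact ⟨1, map_one _⟩
  choose G hG using hmem
  suffices ex : ∃ P : OrientedLink → R, IsAlexanderConway P by
    obtain ⟨P, hP⟩ := ex
    exact ⟨P, hP, fun Q hQ => uniq _ _ hQ hP⟩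
  refine ⟨Quot.lift (fun p => G p.1 p.2) ?_, ?_, ?_⟩
  · intro a b h
    apply inj
    induction h with
    | conj α β => 
      refine (hG _ _).trans (.trans ?_ (hG _ _).symm)
      change F _ β = F _ (α * β * α⁻¹)
      rw [hM.comm, inv_mul_cancel_left]
    | stab β => exact (hG _ _).trans (.trans (hM.stab β).symm (hG _ _).symm)
    | stabInv β => exact (hG _ _).trans (.trans (hM.stabInv β).symm (hG _ _).symm)
  · apply inj
    rw [map_one, ← hF1]
    exact hG _ _
  · intro n α β i
    apply inj
    have := hM.skein n α β i
    rw [← hG, ← hG, ← hG] at this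
    rw [map_zero, ← this, map_sub, map_sub, map_mul]
    rfl

/-- The Alexander–Conway polynomial of an oriented link. -/
def alexanderConway : OrientedLink → ℂ[T;T⁻¹] := existsUnique_alexanderConway.choose

theorem isAlexanderConway_alexanderConway : IsAlexanderConway alexanderConway :=
  existsUnique_alexanderConway.choose_spec.1

/-- The breadth of a Laurent polynomial: the difference between the largest and the smallest
exponent plus one if it is nonzero, and `0` for the zero polynomial. -/
def laurentBreadth (P : ℂ[T;T⁻¹]) : ℤ :=
  if h : P.coeff.support.Nonempty then P.coeff.support.max' h - P.coeff.support.min' h + 1 else 0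

/-- The `3`-braid `x_1^{a_1} x_2^{a_2} ⋯ x_1^{a_{2k-1}} x_2^{a_{2k}}`. -/
def alternatingBraid (k : ℕ) (a : Fin (2 * k) → ℤ) : BraidGroup 3 :=
  (List.ofFn fun i : Fin (2 * k) => x (if (i : ℕ) % 2 = 0 then (0 : Fin 2) else 1) ^ a i).prod

end

/-! The skein relation, together with conjugation and stabilization invariance and the value on the
one-strand braid, determines a function on braids. Hence `alexanderConway` agrees with the
normalized Burau determinant `burauInv` (`IsAlexanderConway.eq_burauInv`). For a positive 3-braid of
length c this reads ∇ · (1 + s² + s⁴) · s^c = s² · det(1 - M) at t = s², with M the reduced 2×2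
Burau matrix over polynomials in t.

For a 2×2 matrix, det(1 - M) = det M + 1 - tr M, and here det M = (-t)^c. Each block x₁^a x₂^b has
entries of degree at most a + b - 1 vanishing at t = 0 (`burauPoly_pair`), so after k blocks the
entries have degree at most c - k and no constant term. Since k ≥ 1, the trace cannot interfere with
either end: det(1 - M) has degree exactly c and constant term 1 (`natDegree_det_one_sub`). Comparing
the extreme exponents of s in the displayed identity puts the top of ∇ at c - 2 and the bottom at 2
- c. -/

open BraidGroup

/-! ### The Conway polynomial as a Burau determinant -/

/-- Any conjugation and stabilization invariant solution of the skein relation is unique. -/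
theorem MarkovSkein.eq {K : Type*} [CommRing K] [IsDomain K] {z : K} (hz : z ≠ 0)
    {f g : ∀ n : ℕ, BraidGroup (n + 1) → K} (hf : MarkovSkein z f) (hg : MarkovSkein z g)
    (h1 : f 0 1 = g 0 1) (n : ℕ) (β : BraidGroup (n + 1)) : f n β = g n β := by
  have hd : MarkovSkein z (fun n (β : BraidGroup (n + 1)) => f n β - g n β) := by
    refine ⟨fun α β => ?_, fun β => ?_, fun β => ?_, fun n α β i => ?_⟩
    · exact congrArg₂ (· - ·) (hf.comm α β) (hg.comm α β)
    · exact congrArg₂ (· - ·) (hf.stab β) (hg.stab β)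
    · exact congrArg₂ (· - ·) (hf.stabInv β) (hg.stabInv β)
    · linear_combination hf.skein n α β i - hg.skein n α β i
  exact sub_eq_zero.1 (AddSubgroup.mem_bot.1 (hd.mem (I := ⊥) hz (by simp) (by simp [h1]) n β))

/-- The ring homomorphism allows a comparison with `burauInv`, which divides by a quantum integer
and so lives over a field. -/
theorem IsAlexanderConway.markovSkein {P : OrientedLink → ℂ[T;T⁻¹]} (hP : IsAlexanderConway P)
    {K : Type*} [CommRing K] (φ : ℂ[T;T⁻¹] →+* K) :
    MarkovSkein (φ (T (-1) - T 1)) (fun _ β => φ (P (closure β))) := by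
  refine ⟨fun α β => congrArg (φ ∘ P) ?_,
    fun β => congrArg (φ ∘ P) (Quot.sound (.stab β)).symm,
    fun β => congrArg (φ ∘ P) (Quot.sound (.stabInv β)).symm, fun n α β i => ?_⟩
  -- Conjugating β * α by α gives α * β.
  · have := Quot.sound (MarkovMove.conj α (β * α))
    rw [← mul_assoc α, mul_inv_cancel_right] at this
    exact this.symm
  · rw [← map_mul, ← map_sub, ← map_sub, hP.skein α β i, map_zero]

/-- The Alexander–Conway polynomial of a closed braid in terms of the Burau representation. -/
theorem IsAlexanderConway.eq_burauInv {P : OrientedLink → ℂ[T;T⁻¹]} (hP : IsAlexanderConway P)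
    {K : Type*} [Field K] (φ : ℂ[T;T⁻¹] →+* K) (hφ : Function.Injective φ) {t : K} (ht : t ≠ 0)
    (s : Kˣ) (hs : (s : K) = φ (T 1)) (hst : t = (s : K) ^ 2) (n : ℕ) (β : BraidGroup (n + 1)) :
    φ (P (closure β)) = burauInv ht s n β := by
  have hs' : (s : K)⁻¹ = φ (T (-1)) := by
    refine inv_eq_of_mul_eq_one_right ?_
    rw [hs, ← map_mul, ← T_add]
    simp
  have hz : φ (T (-1) - T 1) ≠ 0 := by
    rw [Ne, map_eq_zero_iff _ hφ]
    intro h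
    -- At s = 2 the element s⁻¹ - s takes the nonzero value -3/2.
    have h1 := congrArg (eval₂ (RingHom.id ℂ) (Units.mk0 2 two_ne_zero)) h
    rw [map_sub, eval₂_T, eval₂_T, map_zero] at h1
    norm_num at h1
  have hq : ∀ n, qint t (n + 1) ≠ 0 := by
    intro n h
    have h1 : qint t (n + 1) = φ (∑ i ∈ Finset.range (n + 1), (T 1 ^ 2) ^ i) := by
      simp only [qint, hst, hs, map_sum, map_pow]
    rw [h1, map_eq_zero_iff _ hφ] at h
    -- At s = 1 the quantum integer becomes n + 1, which is nonzero in characteristic zero.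
    have h2 := congrArg (eval₂ (RingHom.id ℂ) (1 : ℂˣ)) h
    simp only [map_sum, map_pow, eval₂_T, map_zero] at h2
    simp at h2
    exact Nat.cast_add_one_ne_zero n h2
  have hM := markovSkein_burau ht s hst hq
  rw [hs', hs, ← map_sub] at hM
  exact (hP.markovSkein φ).eq hz hM (by simp [burauInv, qint, hP.unknot]) n β

/-! ### Degrees of Burau matrices on three strands -/

section PolynomialMatrices

open Polynomial Matrix

variable {F : Type*} [Field F]

/-- The reduced Burau matrices of the generators of the braid group on three strands, with
polynomial entries. -/
noncomputable def burauPoly (F : Type*) [Field F] : Fin 2 → Matrix (Fin 2) (Fin 2) F[X] :=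
  ![!![-X, 1; 0, 1], !![1, 0; X, -X]]

/-- Right multiplication by the generator sends (A, B) to (-AX, A + B), so B stays one degree behind
the bound for A. This lag is the source of the degree saved in each block. -/
theorem burauPoly_zero_pow (n : ℕ) : ∃ A B : F[X], A.natDegree ≤ n + 1 ∧ A.coeff 0 = 0 ∧
    B.natDegree ≤ n ∧ burauPoly F 0 ^ (n + 1) = !![A, B; 0, 1] := by
  induction n with
  | zero => exact ⟨-X, 1, by simp, by simp, by simp, by simp [burauPoly]⟩
  | succ n ih =>
    obtain ⟨A, B, hA, hA0, hB, h⟩ := ih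
    refine ⟨-(A * X), A + B, ?_, by simp, ?_, ?_⟩
    · rw [natDegree_neg]
      exact natDegree_mul_le_of_le hA natDegree_X_le
    · exact natDegree_add_le_of_degree_le hA (hB.trans n.le_succ)
    · rw [pow_succ, h]
      simp [burauPoly]

/-- Right multiplication by the generator sends (A, B) to (A + BX, -BX). The whole bottom row
vanishes at zero, unlike the top row for the other generator. -/
theorem burauPoly_one_pow (n : ℕ) : ∃ A B : F[X], A.natDegree ≤ n + 1 ∧ A.coeff 0 = 0 ∧
    B.natDegree ≤ n + 1 ∧ B.coeff 0 = 0 ∧ burauPoly F 1 ^ (n + 1) = !![1, 0; A, B] := by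
  induction n with
  | zero => exact ⟨X, -X, by simp, by simp, by simp, by simp, by simp [burauPoly]⟩
  | succ n ih =>
    obtain ⟨A, B, hA, hA0, hB, hB0, h⟩ := ih
    refine ⟨A + B * X, -(B * X), ?_, by simp [hA0], ?_, by simp, ?_⟩
    · exact natDegree_add_le_of_degree_le (hA.trans (n + 1).le_succ)
        (natDegree_mul_le_of_le hB natDegree_X_le)
    · rw [natDegree_neg]
      exact natDegree_mul_le_of_le hB natDegree_X_le
    · rw [pow_succ, h]
      simp [burauPoly]

/-- The entries of `x_1^(m+1) x_2^(n+1)` have degree less than `m + n + 2` and vanish at zero. -/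
theorem burauPoly_pair (m n : ℕ) (i j : Fin 2) :
    ((burauPoly F 0 ^ (m + 1) * burauPoly F 1 ^ (n + 1)) i j).natDegree ≤ m + n + 1 ∧
      ((burauPoly F 0 ^ (m + 1) * burauPoly F 1 ^ (n + 1)) i j).coeff 0 = 0 := by
  obtain ⟨A, B, hA, hA0, hB, h⟩ := burauPoly_zero_pow (F := F) m
  obtain ⟨C, D, hC, hC0, hD, hD0, h'⟩ := burauPoly_one_pow (F := F) n
  have hBC : (B * C).natDegree ≤ m + n + 1 := natDegree_mul_le_of_le (n := n + 1) hB hC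
  have hBD : (B * D).natDegree ≤ m + n + 1 :=
    natDegree_mul_le_of_le (n := n + 1) hB hD
  -- The product is `!![A + B * C, B * D; C, D]`. Each term contains A, C or D, which vanish at
  -- zero, and the products involve only B, whose bound is m rather than m + 1.
  rw [h, h']
  fin_cases i <;> fin_cases j
  · exact ⟨by simpa using natDegree_add_le_of_degree_le (hA.trans (by omega)) hBC,
      by simp [mul_coeff_zero, hA0, hC0]⟩
  · exact ⟨by simpa using hBD, by simp [mul_coeff_zero, hD0]⟩
  · exact ⟨by simpa using hC.trans (by omega), by simpa using hC0⟩
  · exact ⟨by simpa using hD.trans (by omega), by simpa using hD0⟩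

theorem det_burauPoly (i : Fin 2) : (burauPoly F i).det = -X := by
  fin_cases i <;> simp [burauPoly, det_fin_two]

/-- Only for polynomial entries do degree and constant term make sense; this carries the estimates
to the Burau matrices at t. -/
theorem burauGen_eq_map {K : Type*} [Field K] {t : K} (ht : t ≠ 0) (φ : F[X] →+* K)
    (hφ : φ X = t) (i : Fin 2) : (burauGen ht i).val = (burauPoly F i).map φ := by
  change 1 + burauE t i = _
  ext a b
  fin_cases i <;> fin_cases a <;> fin_cases b <;>
    simp [burauE, burauRow, burauPoly, vecMulVec_apply, hφ]

end PolynomialMatrices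

/-! ### The Burau matrix of an alternating braid -/

theorem alternatingBraid_zero (a : Fin (2 * 0) → ℤ) : alternatingBraid 0 a = 1 := by
  simp [alternatingBraid]

theorem alternatingBraid_succ (k : ℕ) (a : Fin (2 * (k + 1)) → ℤ) :
    alternatingBraid (k + 1) a = x 0 ^ a 0 * x 1 ^ a 1 *
      alternatingBraid k (fun i => a (Fin.succ (Fin.succ i))) := by
  rw [alternatingBraid, mul_assoc]
  change (List.ofFn (n := 2 * k + 1 + 1) _).prod = _
  rw [List.ofFn_succ, List.ofFn_succ, List.prod_cons, List.prod_cons]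
  simp [alternatingBraid, add_assoc]

open Polynomial Matrix in
/-- The Burau matrix of an alternating positive three-braid of length `c`: its entries have degree
less than `c` and vanish at zero. -/
theorem exists_burau_alternatingBraid {F K : Type*} [Field F] [Field K] {t : K} (ht : t ≠ 0)
    (φ : F[X] →+* K) (hφ : φ X = t) (u : Kˣ) (k : ℕ) (a : Fin (2 * k) → ℤ) (ha : ∀ i, 1 ≤ a i) :
    ∃ (c : ℕ) (M : Matrix (Fin 2) (Fin 2) F[X]), (c : ℤ) = ∑ i, a i ∧
      (burau ht 2 (alternatingBraid k a)).val = M.map φ ∧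
      expHom u 2 (alternatingBraid k a) = u ^ c ∧ M.det = (-X) ^ c ∧
      ∀ i j, (M i j).natDegree + k ≤ c ∧ (k ≠ 0 → (M i j).coeff 0 = 0) := by
  induction k with
  | zero =>
    -- The empty braid gives the identity matrix, whose diagonal does not vanish at zero; hence the
    -- guard `k ≠ 0`.
    refine ⟨0, 1, by simp, ?_, by simp [alternatingBraid_zero], by simp, fun i j => ⟨?_, by simp⟩⟩
    · rw [alternatingBraid_zero, map_one, Units.val_one, Matrix.map_one _ (map_zero φ) (map_one φ)]
    · rw [one_apply]; split_ifs <;> simp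
  | succ k ih =>
    obtain ⟨c, M, hc, hM, hu, hdet, hdeg⟩ := ih (fun i => a (Fin.succ (Fin.succ i)))
      fun i => ha _
    obtain ⟨m, hm⟩ : ∃ m : ℕ, a 0 = (m + 1 : ℕ) :=
      ⟨(a 0 - 1).toNat, by have := ha 0; omega⟩
    obtain ⟨n, hn⟩ : ∃ n : ℕ, a 1 = (n + 1 : ℕ) :=
      ⟨(a 1 - 1).toNat, by have := ha 1; omega⟩
    refine ⟨m + 1 + (n + 1) + c, burauPoly F 0 ^ (m + 1) * burauPoly F 1 ^ (n + 1) * M,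
      ?_, ?_, ?_, ?_, fun i j => ⟨?_, fun _ => ?_⟩⟩
    · change _ = ∑ i : Fin (2 * k + 1 + 1), a i
      rw [Fin.sum_univ_succ, Fin.sum_univ_succ, ← hc]
      change _ = a 0 + (a 1 + _)
      rw [hm, hn]
      push_cast
      ring
    · rw [alternatingBraid_succ, hm, hn, zpow_natCast, zpow_natCast]
      simp only [map_mul, map_pow, Units.val_mul, Units.val_pow_eq_pow_val, burau_x,
        burauGen_eq_map ht φ hφ, hM, Matrix.map_mul, Matrix.map_pow]
    · rw [alternatingBraid_succ, hm, hn, zpow_natCast, zpow_natCast, map_mul, map_mul, map_pow,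
        map_pow, expHom_x, expHom_x, hu, ← pow_add, ← pow_add]
    · rw [det_mul, det_mul, det_pow, det_pow, det_burauPoly, det_burauPoly, hdet,
        ← pow_add, ← pow_add]
    -- The new block contributes one less than its length m + n + 2, so the total saving rises from
    -- k to k + 1. The truncated subtraction is harmless because `hdeg` forces k ≤ c.
    · have h : ∀ l, ((burauPoly F 0 ^ (m + 1) * burauPoly F 1 ^ (n + 1)) i l * M l j).natDegree
          ≤ m + n + 1 + (c - k) := fun l =>
        natDegree_mul_le_of_le (burauPoly_pair m n i l).1 (by have := (hdeg l j).1; omega)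
      have h2 := natDegree_add_le_of_degree_le (h 0) (h 1)
      rw [mul_apply, Fin.sum_univ_two]
      have := (hdeg 0 0).1
      omega
    -- Vanishing at zero comes from the new block alone, so it already holds when M is the identity.
    · rw [mul_apply, Fin.sum_univ_two]
      simp [mul_coeff_zero, (burauPoly_pair (F := F) m n i _).2]

/-! ### Extreme exponents -/

/-- The degree and the breadth of a Laurent polynomial whose product with a power of `T` is
a given polynomial. -/
theorem laurent_degree_breadth {P : ℂ[T;T⁻¹]} {p : Polynomial ℂ} {n : ℕ} (hp : p ≠ 0)
    (h : Polynomial.toLaurent p = P * T n) :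
    LaurentPolynomial.degree P = (((p.natDegree : ℤ) - n : ℤ) : WithBot ℤ) ∧
      laurentBreadth P = (p.natDegree : ℤ) - p.natTrailingDegree + 1 := by
  have hsupp : ∀ j : ℤ, j ∈ P.coeff.support ↔ ∃ i ∈ p.support, (i : ℤ) = j + n := by
    intro j
    have h1 : P.coeff j = (Polynomial.toLaurent p).coeff (j + n) := by
      rw [h, T, AddMonoidAlgebra.coeff_mul_single_eq_coeff_mul j (by simp), mul_one]
    have h2 : j ∈ P.coeff.support ↔ j + n ∈ (Polynomial.toLaurent p).coeff.support := by
      rw [Finsupp.mem_support_iff, Finsupp.mem_support_iff, h1]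
    rw [h2, support_coeff_toLaurent]
    exact Finset.mem_map
  have hmax : (p.natDegree : ℤ) - n ∈ P.coeff.support :=
    (hsupp _).2 ⟨p.natDegree, Polynomial.natDegree_mem_support_of_nonzero hp, by ring⟩
  have hmin : (p.natTrailingDegree : ℤ) - n ∈ P.coeff.support :=
    (hsupp _).2 ⟨p.natTrailingDegree, Polynomial.natTrailingDegree_mem_support_of_nonzero hp,
      by ring⟩
  have hle : ∀ j ∈ P.coeff.support, j ≤ p.natDegree - n ∧ p.natTrailingDegree - n ≤ j := by
    intro j hj
    obtain ⟨i, hi, hij⟩ := (hsupp j).1 hj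
    have h1 := Polynomial.le_natDegree_of_mem_supp i hi
    have h2 := Polynomial.natTrailingDegree_le_of_mem_supp i hi
    omega
  have hne : P.coeff.support.Nonempty := ⟨_, hmax⟩
  have e1 : P.coeff.support.max' hne = p.natDegree - n :=
    le_antisymm (Finset.max'_le _ _ _ fun j hj => (hle j hj).1) (Finset.le_max' _ _ hmax)
  have e2 : P.coeff.support.min' hne = p.natTrailingDegree - n :=
    le_antisymm (Finset.min'_le _ _ hmin) (Finset.le_min' _ _ _ fun j hj => (hle j hj).2)
  refine ⟨?_, ?_⟩
  · rw [LaurentPolynomial.degree, ← Finset.coe_max' hne, e1]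
  · rw [laurentBreadth, dif_pos hne, e1, e2]
    ring

open Polynomial Matrix in
/-- The characteristic polynomial at one of a matrix over a polynomial ring whose determinant
dominates the entries, which vanish at zero. -/
theorem natDegree_det_one_sub {F : Type*} [Field F] {c : ℕ} {M : Matrix (Fin 2) (Fin 2) F[X]}
    (hdet : M.det = (-X) ^ c) (h : ∀ i j, (M i j).natDegree < c ∧ (M i j).coeff 0 = 0) :
    (1 - M).det.natDegree = c ∧ (1 - M).det.coeff 0 = 1 := by
  have hc : c ≠ 0 := ((Nat.zero_le _).trans_lt (h 0 0).1).ne'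
  have e : (1 - M).det = (-X) ^ c + (1 - (M 0 0 + M 1 1)) := by
    rw [← hdet, det_fin_two, det_fin_two]
    simp
    ring
  -- The term 1 - tr M has degree at most c - 1, so (-X)^c alone decides the degree.
  have h1 : (1 - (M 0 0 + M 1 1)).natDegree < ((-X : F[X]) ^ c).natDegree := by
    have := natDegree_add_le_of_degree_le (Nat.le_sub_one_of_lt (h 0 0).1)
      (Nat.le_sub_one_of_lt (h 1 1).1)
    have := natDegree_sub_le_of_le (p := (1 : F[X])) (m := 0) (by simp) this
    rw [natDegree_pow, natDegree_neg, natDegree_X]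
    omega
  rw [e]
  refine ⟨?_, ?_⟩
  · rw [natDegree_add_eq_left_of_natDegree_lt h1, natDegree_pow, natDegree_neg, natDegree_X,
      mul_one]
  · simp [coeff_zero_eq_eval_zero] at h ⊢
    simp [h, hc]

-- Over a domain both degree and trailing degree are additive. The top exponents satisfy deg P + 4 +
-- c = 2 + 2c; at the bottom the factors with nonzero constant term contribute 0, so the lowest
-- exponent plus c equals 2.
open Polynomial in
theorem degree_breadth_of_qint_mul {P : ℂ[T;T⁻¹]} {N : ℂ[X]} {c : ℕ} (hdeg : N.natDegree = c)
    (h0 : N.coeff 0 ≠ 0)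
    (h : P * toLaurent (1 + X ^ 2 + X ^ 4) * T c = T 2 * toLaurent (expand ℂ 2 N)) :
    LaurentPolynomial.degree P = (((c : ℤ) - 2 : ℤ) : WithBot ℤ) ∧
      laurentBreadth P = 2 * (c : ℤ) - 3 := by
  -- Multiplying by a power of s clears the negative exponents, so that the comparison takes place
  -- among polynomials.
  obtain ⟨n, p, hp⟩ := exists_T_pow P
  have hN : N ≠ 0 := by rintro rfl; simp at h0
  have hE : expand ℂ 2 N ≠ 0 := (expand_ne_zero two_pos).2 hN
  have hE0 : (expand ℂ 2 N).natTrailingDegree = 0 :=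
    natTrailingDegree_eq_zero.2 (Or.inr (by simpa [coeff_expand] using h0))
  have hQ1 : (1 + X ^ 2 + X ^ 4 : ℂ[X]).natDegree = 4 := by compute_degree!
  have hQ : (1 + X ^ 2 + X ^ 4 : ℂ[X]) ≠ 0 := by
    intro h; rw [h] at hQ1; simp at hQ1
  have hQ0 : (1 + X ^ 2 + X ^ 4 : ℂ[X]).natTrailingDegree = 0 :=
    natTrailingDegree_eq_zero.2 (Or.inr (by simp [coeff_one, coeff_X_pow]))
  have key : p * (1 + X ^ 2 + X ^ 4) * X ^ c = X ^ (n + 2) * expand ℂ 2 N := by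
    apply toLaurent_injective
    rw [map_mul, map_mul, map_mul, toLaurent_X_pow, toLaurent_X_pow, hp, Nat.cast_add, T_add]
    push_cast
    linear_combination T (n : ℤ) * h
  have hp0 : p ≠ 0 := by
    rintro rfl
    rw [zero_mul, zero_mul] at key
    exact mul_ne_zero (pow_ne_zero _ X_ne_zero) hE key.symm
  have k1 := congrArg natDegree key
  have k2 := congrArg natTrailingDegree key
  rw [natDegree_mul (mul_ne_zero hp0 hQ) (pow_ne_zero _ X_ne_zero), natDegree_mul hp0 hQ,
    natDegree_mul (pow_ne_zero _ X_ne_zero) hE, natDegree_X_pow, natDegree_X_pow, natDegree_expand,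
    hQ1, hdeg] at k1
  rw [natTrailingDegree_mul (mul_ne_zero hp0 hQ) (pow_ne_zero _ X_ne_zero),
    natTrailingDegree_mul hp0 hQ, natTrailingDegree_mul (pow_ne_zero _ X_ne_zero) hE,
    natTrailingDegree_X_pow, natTrailingDegree_X_pow, hE0, hQ0] at k2
  obtain ⟨r1, r2⟩ := laurent_degree_breadth hp0 hp
  refine ⟨r1.trans (congrArg _ ?_), r2.trans ?_⟩ <;> omega

/-! ### The degree and breadth formulas -/

theorem mainTheorem9 (k : ℕ) (hk : 1 ≤ k) (a : Fin (2 * k) → ℤ) (ha : ∀ i, 2 ≤ a i) :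
    LaurentPolynomial.degree (alexanderConway (BraidGroup.closure (alternatingBraid k a))) =
        (((∑ i, a i) - 2 : ℤ) : WithBot ℤ) ∧
      laurentBreadth (alexanderConway (BraidGroup.closure (alternatingBraid k a))) =
        2 * (∑ i, a i) - 3 := by
  let K := FractionRing ℂ[T;T⁻¹]
  let φ : ℂ[T;T⁻¹] →+* K := algebraMap _ _
  have hφ : Function.Injective φ := IsFractionRing.injective _ K
  let s : Kˣ := Units.map (φ : ℂ[T;T⁻¹] →* K) (isUnit_T 1).unit
  have hs : (s : K) = φ (T 1) := rfl
  have ht : (s : K) ^ 2 ≠ 0 := pow_ne_zero 2 s.ne_zero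
  -- The polynomial variable is the Burau parameter t = s², hence the expansion by 2 before passing
  -- to Laurent polynomials.
  let ψ : Polynomial ℂ →+* K :=
    (φ.comp Polynomial.toLaurent).comp (Polynomial.expand ℂ 2 : Polynomial ℂ →+* Polynomial ℂ)
  have hψ : ψ Polynomial.X = (s : K) ^ 2 := by
    change φ (Polynomial.toLaurent (Polynomial.expand ℂ 2 .X)) = _
    rw [Polynomial.expand_X, Polynomial.toLaurent_X_pow, hs, ← map_pow, T_pow]
    rfl
  obtain ⟨c, M, hc, hM, hu, hdet, h⟩ := exists_burau_alternatingBraid ht ψ hψ s⁻¹ k a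
    fun i => one_le_two.trans (ha i)
  -- Here k ≥ 1 enters: it turns degree + k ≤ c into a strict inequality and activates the vanishing
  -- at zero.
  obtain ⟨hN, hN0⟩ := natDegree_det_one_sub hdet fun i j =>
    ⟨by have := (h i j).1; omega, (h i j).2 (by omega)⟩
  rw [← hc]
  refine degree_breadth_of_qint_mul hN (by simp [hN0]) (hφ ?_)
  have e := isAlexanderConway_alexanderConway.eq_burauInv φ hφ ht s hs rfl 2 (alternatingBraid k a)
  have hdet' : (1 - M.map ψ).det = ψ (1 - M).det := by
    rw [RingHom.map_det, map_sub, map_one]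
    rfl
  have hq : qint ((s : K) ^ 2) 3 = φ (Polynomial.toLaurent (1 + .X ^ 2 + .X ^ 4)) := by
    simp only [qint, Finset.sum_range_succ, Finset.sum_range_zero, hs, ← map_pow, map_add, map_one,
      Polynomial.toLaurent_X_pow, T_pow]
    norm_num
  have hq0 : qint ((s : K) ^ 2) 3 ≠ 0 := by
    rw [hq, Ne, map_eq_zero_iff _ hφ, Polynomial.toLaurent_eq_zero]
    intro h
    have := congrArg (Polynomial.eval 1) h
    norm_num at this
  have hT : φ (T c) = (s : K) ^ c := by rw [hs, ← map_pow, T_pow, mul_one]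
  have hT2 : φ (T 2) = (s : K) ^ 2 := by rw [hs, ← map_pow, T_pow]; rfl
  rw [burauInv, hM, hu, hdet'] at e
  rw [map_mul, map_mul, map_mul, e, ← hq, hT, hT2]
  change _ = _ * ψ (1 - M).det
  have hs0 := s.ne_zero
  -- The factor s^(-c) comes from the exponent-sum normalization in `burauInv`.
  have hsc : (s : K)⁻¹ ^ c * (s : K) ^ c = 1 := by
    rw [← mul_pow, inv_mul_cancel₀ hs0, one_pow]
  push_cast
  rw [div_mul_cancel₀ _ hq0]
  linear_combination (s : K) ^ 2 * ψ (1 - M).det * hsc
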